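/- Let $G$ be a virtually nilpotent group (that is, $G$ has a nilpotent subgroup of finite index), and let $A\subseteq G$ be finite and non-empty. For subsets $E,F\subseteq G$ write $EF=\{ef : e\in E,\ f\in F\}$, and for $h\ge 1$ let $A^h=\{a_1a_2\cdots a_h : a_i\in A\}$ be the set of products of exactly $h$ elements of $A$. Let $\Gamma=\langle A\rangle$ be the subgroup generated by $A$, and let $S\subseteq\Gamma$ be a finite symmetric ($S^{-1}=S$) generating set of $\Gamma$ containing the identity $e$. Let $\ell_S(g)=\min\{n\ge 0 : g\in S^n\}$ for $g\in\Gamma$, where $S^0=\{e\}$, and let $B_S(n)=\{g\in\Gamma : \ell_S(g)\le n\}$. Suppose that there exist a real number $\theta>0$ and an integer $h_1\ge 1$ such that $$B_S(\lfloor\theta h\rfloor)\subseteq A^h\qquad\text{for every integer } h\ge h_1.$$ Then $A$ is an asymptotic approximate group: for every integer $r\ge 1$ there exist an integer $l\ge 1$ and an integer $h_0\ge 1$ such that for every integer $h\ge h_0$ there is a set $X_h\subseteq G$ with $$|X_h|\le l\qquad\text{and}\qquad A^{rh}\subseteq X_hA^h.$$ -/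

import Mathlib

open scoped Pointwise

/-- `A` is an asymptotic `(r, l)`-approximate group: `A` is non-empty and, for all large `h`, the
set `A ^ (r * h)` of products of exactly `r * h` elements of `A` is covered by at most `l` left
translates of `A ^ h`. -/
def IsAsymptoticRLApproximateGroup {G : Type*} [Group G] (r l : ℕ) (A : Set G) : Prop :=
  A.Nonempty ∧ ∃ h₀ : ℕ, 1 ≤ h₀ ∧ ∀ h : ℕ, h₀ ≤ h →
    ∃ X : Finset G, X.card ≤ l ∧ A ^ (r * h) ⊆ (X : Set G) * A ^ h

/-- `A` is an asymptotic approximate group: for every `r ≥ 1` there is `l ≥ 1` such that `A` is an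
asymptotic `(r, l)`-approximate group. -/
def IsAsymptoticApproximateGroup {G : Type*} [Group G] (A : Set G) : Prop :=
  ∀ r : ℕ, 1 ≤ r → ∃ l : ℕ, 1 ≤ l ∧ IsAsymptoticRLApproximateGroup r l A

/-- The word length of `g` with respect to `S`: the least `n ≥ 0` with `g ∈ S ^ n`
(meaningful for `g` in the subgroup generated by a symmetric set `S` containing `1`). -/
noncomputable def wordLength {G : Type*} [Group G] (S : Set G) (g : G) : ℕ :=
  sInf {n : ℕ | g ∈ S ^ n}

/-- The word ball of radius `n` in the subgroup generated by `S`. -/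
def wordBall {G : Type*} [Group G] (S : Set G) (n : ℕ) : Set G :=
  {g : G | g ∈ Subgroup.closure S ∧ wordLength S g ≤ n}

/-! Since `A ⊆ S ^ m`, the set `A ^ (r * h)` lies in a ball of radius O(h), while `A ^ h` contains a
ball of radius ⌊θh⌋. So it suffices to cover `S ^ (K * n)` by boundedly many translates of `S ^ n`.
This is proved directly, without growth estimates.

In the nilpotent case, let an iterated commutator of weight k cost n⁻ᵏ at scale n. Products,
conjugates and commutators of words of bounded cost then have cost bounded independently of n
(`WordCost.comm`). A word of cost C collects to uᵃw with u of lowest weight k and a ≤ C nᵏ. Write a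
= q nᵏ + r with r < nᵏ. There are boundedly many q, and uʳ is an element of length O(n) times a
bounded-cost word of higher weight (`IterComm.pow_mem_sup`). Removing letters in this way
(`HasCovering.insert`), by descending induction on weight, gives the covering. Schreier generators
handle finite index. -/

/-- The commutator `g⁻¹ v⁻¹ g v`, so that `v⁻¹ g v = g * rcomm g v`. -/
def rcomm {G : Type*} [Group G] (g v : G) : G := g⁻¹ * v⁻¹ * g * v

/-- `IterComm S k u`: `u` is an iterated commutator of weight `k` in elements of `S`. -/
inductive IterComm {G : Type*} [Group G] (S : Set G) : ℕ → G → Prop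
  | base {s : G} : s ∈ S → IterComm S 1 s
  | comm {i j : ℕ} {x y : G} : IterComm S i x → IterComm S j y → IterComm S (i + j) (rcomm x y)

/-- `WordCost P x g c`: `g` is a word in the weighted alphabet `P` of total cost at most `c`, where
a letter of weight `k` costs `x ^ k`. -/
inductive WordCost {G : Type*} [Group G] (P : ℕ → G → Prop) (x : ℝ) : G → ℝ → Prop
  | one {c : ℝ} : 0 ≤ c → WordCost P x 1 c
  | mul_letter {g t : G} {k : ℕ} {c d : ℝ} :
      WordCost P x g c → P k t → c + x ^ k ≤ d → WordCost P x (g * t) d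

/-! ### Commutator calculus for weighted words -/

section Words

variable {G : Type*} [Group G]

theorem conj_eq_mul_rcomm (g v : G) : v⁻¹ * g * v = g * rcomm g v := by
  simp only [rcomm]; group

theorem rcomm_mul_right (t v u : G) : rcomm t (v * u) = rcomm t u * (u⁻¹ * rcomm t v * u) := by
  simp only [rcomm]; group

theorem rcomm_mul_left (g t v : G) : rcomm (g * t) v = t⁻¹ * rcomm g v * t * rcomm t v := by
  simp only [rcomm]; group

theorem rcomm_inv (x y : G) : (rcomm x y)⁻¹ = rcomm y x := by
  simp only [rcomm]; group

@[simp] theorem rcomm_one_left (v : G) : rcomm 1 v = 1 := by simp [rcomm]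

@[simp] theorem rcomm_one_right (v : G) : rcomm v 1 = 1 := by simp [rcomm]

namespace WordCost

variable {P Q R : ℕ → G → Prop} {x c d : ℝ} {g h v : G}

theorem nonneg (hx : 0 ≤ x) (h : WordCost P x g c) : 0 ≤ c := by
  induction h with
  | one h => exact h
  | mul_letter _ _ hd ih => exact (add_nonneg ih (pow_nonneg hx _)).trans hd

theorem mono (h : WordCost P x g c) (hcd : c ≤ d) : WordCost P x g d := by
  cases h with
  | one h => exact .one (h.trans hcd)
  | mul_letter hg ht hd => exact .mul_letter hg ht (hd.trans hcd)

theorem imp (h : WordCost P x g c) (hPQ : ∀ k t, P k t → Q k t) : WordCost Q x g c := by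
  induction h with
  | one h => exact .one h
  | mul_letter _ ht hd ih => exact .mul_letter ih (hPQ _ _ ht) hd

theorem map {H : Type*} [Group H] {Q : ℕ → H → Prop} (f : G →* H) (h : WordCost P x g c)
    (hPQ : ∀ k t, P k t → Q k (f t)) : WordCost Q x (f g) c := by
  induction h with
  | one h => rw [map_one]; exact .one h
  | mul_letter _ ht hd ih => rw [map_mul]; exact .mul_letter ih (hPQ _ _ ht) hd

theorem letter {k : ℕ} {t : G} (ht : P k t) : WordCost P x t (x ^ k) := by
  simpa using WordCost.mul_letter (.one le_rfl) ht (by simp)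

theorem mul (hg : WordCost P x g c) (hh : WordCost P x h d) : WordCost P x (g * h) (c + d) := by
  induction hh with
  | one h => rw [mul_one]; exact hg.mono (by linarith)
  | mul_letter _ ht hd ih => rw [← mul_assoc]; exact .mul_letter ih ht (by linarith)

theorem inv (hP : ∀ k t, P k t → P k t⁻¹) (hg : WordCost P x g c) : WordCost P x g⁻¹ c := by
  induction hg with
  | one h => rw [inv_one]; exact .one h
  | mul_letter _ ht hd ih =>
    rw [mul_inv_rev]; exact ((letter (hP _ _ ht)).mul ih).mono (by linarith)

theorem pow {k : ℕ} {t : G} (ht : P k t) (n : ℕ) : WordCost P x (t ^ n) (n * x ^ k) := by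
  induction n with
  | zero => rw [pow_zero]; exact .one (by simp)
  | succ n ih => rw [pow_succ]; exact .mul_letter ih ht (by push_cast; linarith)

/-- Conjugation by u replaces each letter t by t · [t, u], which multiplies its cost by 1 + xʲ. -/
theorem conj_letter (hx : 0 ≤ x) {j : ℕ} {u : G}
    (hu : ∀ k t, P k t → P (k + j) (rcomm t u)) (hg : WordCost P x g c) :
    WordCost P x (u⁻¹ * g * u) (c * (1 + x ^ j)) := by
  have hxj : 0 ≤ x ^ j := pow_nonneg hx j
  induction hg with
  | one h => rw [mul_one, inv_mul_cancel]; exact .one (by positivity)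
  | @mul_letter g t k c d _ ht hd ih =>
    have h1 : u⁻¹ * (g * t) * u = u⁻¹ * g * u * t * rcomm t u := by
      simp only [rcomm]; group
    rw [h1]
    refine .mul_letter (.mul_letter ih ht le_rfl) (hu _ _ ht) ?_
    calc c * (1 + x ^ j) + x ^ k + x ^ (k + j) = (c + x ^ k) * (1 + x ^ j) := by ring
      _ ≤ d * (1 + x ^ j) := by gcongr

/-- Each letter of cost y contributes a factor 1 + y ≤ eʸ, so cost bounds are exponentials of total
cost, independent of word length and scale. -/
theorem mul_one_add_le_exp {A c d y : ℝ} (hA : 0 ≤ A) (h : c + y ≤ d) :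
    A * Real.exp c * (1 + y) ≤ A * Real.exp d := by
  have h1 : 1 + y ≤ Real.exp y := by linarith [Real.add_one_le_exp y]
  calc A * Real.exp c * (1 + y) ≤ A * Real.exp c * Real.exp y := by gcongr
    _ = A * Real.exp (c + y) := by rw [Real.exp_add]; ring
    _ ≤ A * Real.exp d := by gcongr

theorem conj (hx : 0 ≤ x) (hPQ : ∀ a b t v, P a t → Q b v → P (a + b) (rcomm t v))
    (hg : WordCost P x g c) (hv : WordCost Q x v d) :
    WordCost P x (v⁻¹ * g * v) (c * Real.exp d) := by
  have hc := hg.nonneg hx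
  induction hv with
  | @one d h =>
    rw [inv_one, one_mul, mul_one]
    exact hg.mono (le_mul_of_one_le_right hc (Real.one_le_exp h))
  | @mul_letter v u k d d' _ hu hd ih =>
    have h1 : (v * u)⁻¹ * g * (v * u) = u⁻¹ * (v⁻¹ * g * v) * u := by group
    rw [h1]
    exact (ih.conj_letter hx fun a t ht => hPQ a k t u ht hu).mono (mul_one_add_le_exp hc hd)

theorem rcomm_letter (hx : 0 ≤ x) (hPQ : ∀ a b t v, P a t → Q b v → R (a + b) (rcomm t v))
    (hRQ : ∀ a b t v, R a t → Q b v → R (a + b) (rcomm t v))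
    {a : ℕ} {t : G} (ht : P a t) (hv : WordCost Q x v d) :
    WordCost R x (rcomm t v) (x ^ a * (Real.exp d - 1)) := by
  have hxa : 0 ≤ x ^ a := pow_nonneg hx a
  induction hv with
  | @one d h =>
    rw [rcomm_one_right]
    exact .one (mul_nonneg hxa (by linarith [Real.one_le_exp h]))
  | @mul_letter v u k d d' _ hu hd ih =>
    rw [rcomm_mul_right]
    refine ((letter (hPQ _ _ _ _ ht hu)).mul
      (ih.conj_letter hx fun b t' ht' => hRQ b k t' u ht' hu)).mono ?_
    have := mul_one_add_le_exp hxa hd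
    rw [pow_add]
    linarith

theorem comm (hx : 0 ≤ x) (hPQ : ∀ a b t v, P a t → Q b v → R (a + b) (rcomm t v))
    (hRQ : ∀ a b t v, R a t → Q b v → R (a + b) (rcomm t v))
    (hRP : ∀ a b t v, R a t → P b v → R (a + b) (rcomm t v))
    (hg : WordCost P x g c) (hv : WordCost Q x v d) :
    WordCost R x (rcomm g v) ((Real.exp c - 1) * (Real.exp d - 1)) := by
  have hd : 0 ≤ Real.exp d - 1 := by linarith [Real.one_le_exp (hv.nonneg hx)]
  induction hg with
  | @one c h =>
    rw [rcomm_one_left]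
    exact .one (mul_nonneg (by linarith [Real.one_le_exp h]) hd)
  | @mul_letter g t k c c' _ ht hc ih =>
    rw [rcomm_mul_left]
    refine ((ih.conj_letter hx fun b t' ht' => hRP b k t' t ht' ht).mul
      (hv.rcomm_letter hx hPQ hRQ ht)).mono ?_
    have := mul_one_add_le_exp hd hc
    linarith

/-- All occurrences of a letter `u` in a word can be collected on its left. -/
theorem exists_eq_pow_mul (hx : 0 ≤ x) {k : ℕ} {u : G}
    (hPQ : ∀ a t, P a t → (a = k ∧ t = u) ∨ Q a t)
    (hQ : ∀ a t, Q a t → Q (a + k) (rcomm t u)) (hg : WordCost P x g c) :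
    ∃ (a : ℕ) (w : G), g = u ^ a * w ∧ a * x ^ k ≤ c ∧ WordCost Q x w (c * Real.exp c) := by
  induction hg with
  | @one c h => exact ⟨0, 1, by simp, by simpa using h, .one (by positivity)⟩
  | @mul_letter g t j c d hg ht hd ih =>
    obtain ⟨a, w, rfl, hac, hw⟩ := ih
    have hc := hg.nonneg hx
    have hxj : 0 ≤ x ^ j := pow_nonneg hx j
    have hd0 : 0 ≤ d := by linarith
    rcases hPQ _ _ ht with ⟨rfl, rfl⟩ | ht
    -- A new u moves left through w, which becomes its conjugate.
    · refine ⟨a + 1, t⁻¹ * w * t, by rw [pow_succ]; group, by push_cast; linarith,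
        (hw.conj_letter hx hQ).mono ((mul_one_add_le_exp hc hd).trans ?_)⟩
      gcongr
      linarith
    · refine ⟨a, w * t, by rw [mul_assoc], by linarith, .mul_letter hw ht ?_⟩
      calc c * Real.exp c + x ^ j ≤ c * Real.exp d + x ^ j * Real.exp d := by
            gcongr
            · linarith
            · exact le_mul_of_one_le_right hxj (Real.one_le_exp hd0)
        _ ≤ d * Real.exp d := by rw [← add_mul]; gcongr

end WordCost

end Words

/-! ### Iterated commutators and nilpotency -/

section IteratedCommutators

variable {G : Type*} [Group G] {S : Set G}

theorem WordCost.eq_one {P : ℕ → G → Prop} {x c : ℝ} {g : G} (h : WordCost P x g c)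
    (hP : ∀ k t, P k t → t = 1) : g = 1 := by
  induction h with
  | one => rfl
  | mul_letter _ ht _ ih => rw [ih, hP _ _ ht, mul_one]

namespace IterComm

theorem pos {k : ℕ} {u : G} (h : IterComm S k u) : 1 ≤ k := by
  induction h with
  | base => exact le_rfl
  | comm => omega

theorem inv (hS : S⁻¹ = S) {k : ℕ} {u : G} (h : IterComm S k u) : IterComm S k u⁻¹ := by
  cases h with
  | base h => exact .base (by rw [← hS]; simpa using h)
  | @comm i j _ _ hx hy => rw [rcomm_inv, add_comm]; exact .comm hy hx

theorem finite (hS : S.Finite) (k : ℕ) : {u | IterComm S k u}.Finite := by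
  induction k using Nat.strong_induction_on with
  | _ k ih =>
    refine (hS.union ((Finset.range k).finite_toSet.biUnion (t := fun i =>
      -- Excluding i = 0 keeps both weights below k.
      if i = 0 then ∅ else
        Set.image2 rcomm {u | IterComm S i u} {u | IterComm S (k - i) u}) ?_)).subset ?_
    · intro i hi
      have hi : i < k := by simpa using hi
      split_ifs with h
      · exact Set.finite_empty
      · exact (ih i hi).image2 _ (ih (k - i) (by omega))
    · rintro _ (h | @⟨i, j, x, y, hx, hy⟩)
      · exact .inl h
      · have := hx.pos
        have := hy.pos
        refine .inr (Set.mem_biUnion (x := i) (by simp; omega) ?_)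
        rw [if_neg (by omega)]
        exact ⟨x, hx, y, by simpa using hy, rfl⟩

/-- One entry of a commutator carries at least half the weight. The resulting bound 2 ^ m is crude,
but enough to make high weights trivial. -/
theorem mem_lowerCentralSeries {N : Subgroup G} (hS : S ⊆ N) {k : ℕ} {u : G}
    (h : IterComm S k u) : ∀ m, 2 ^ m ≤ k → u ∈ N.lowerCentralSeries m := by
  have h0 : ∀ {k u}, IterComm S k u → u ∈ N := by
    intro k u h
    induction h with
    | base h => exact hS h
    | comm _ _ hx hy =>
      exact N.mul_mem (N.mul_mem (N.mul_mem (N.inv_mem hx) (N.inv_mem hy)) hx) hy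
  have key : ∀ m a b, a ∈ N.lowerCentralSeries m → b ∈ N →
      rcomm a b ∈ N.lowerCentralSeries (m + 1) := fun m a b ha hb => by
    have := Subgroup.commutator_mem_commutator (inv_mem ha) (N.inv_mem hb)
    rwa [commutatorElement_def, inv_inv, inv_inv] at this
  induction h with
  | @base s h =>
    intro m hm
    obtain rfl : m = 0 := by
      by_contra h0
      have := Nat.one_lt_two_pow h0
      omega
    exact hS h
  | @comm i j x y hx hy ihx ihy =>
    intro m hm
    cases m with
    | zero => exact h0 (.comm hx hy)
    | succ m =>
      rw [pow_succ] at hm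
      rcases le_or_gt (2 ^ m) i with h | h
      · exact key _ _ _ (ihx m h) (h0 hy)
      · rw [← rcomm_inv]
        exact inv_mem (key _ _ _ (ihy m (by omega)) (h0 hx))

theorem exists_eq_one {N : Subgroup G} (hN : Group.IsNilpotent N) (hS : S ⊆ N) :
    ∃ K, ∀ k, K ≤ k → ∀ u, IterComm S k u → u = 1 := by
  obtain ⟨m, hm⟩ := N.isNilpotent_iff_lowerCentralSeries.1 hN
  refine ⟨2 ^ m, fun k hk u hu => ?_⟩
  have := hu.mem_lowerCentralSeries hS m hk
  rwa [hm, Subgroup.mem_bot] at this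

end IterComm

/-- The alphabet of iterated commutators of weight at least `k`. -/
def CommGE (S : Set G) (k a : ℕ) (t : G) : Prop := k ≤ a ∧ IterComm S a t

theorem CommGE.comm {i j a b : ℕ} {t v : G} (ht : CommGE S i a t) (hv : CommGE S j b v) :
    CommGE S (i + j) (a + b) (rcomm t v) :=
  ⟨add_le_add ht.1 hv.1, .comm ht.2 hv.2⟩

theorem CommGE.mono {i j a : ℕ} {t : G} (h : CommGE S j a t) (hij : i ≤ j) : CommGE S i a t :=
  ⟨hij.trans h.1, h.2⟩

/-- Expanding both powers produces copies of [x, y] and commutators of higher weight; collecting the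
copies leaves an error whose cost is bounded in terms of c and d. -/
theorem IterComm.exists_rcomm_pow_pow {i j : ℕ} {x y : G} (hx : IterComm S i x)
    (hy : IterComm S j y) {z : ℝ} (hz : 0 ≤ z) (p q : ℕ) {c d : ℝ} (hp : p * z ^ i ≤ c)
    (hq : q * z ^ j ≤ d) :
    ∃ w, rcomm (x ^ p) (y ^ q) = rcomm x y ^ (p * q) * w ∧
      WordCost (CommGE S (i + j + 1)) z w ((Real.exp c - 1) * (Real.exp d - 1) *
        Real.exp ((Real.exp c - 1) * (Real.exp d - 1))) := by
  -- The ℤ-coordinate counts occurrences of [x, y] with all other letters counting 0, so the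
  -- collected exponent is seen to be exactly p * q.
  let Q : ℕ → G × Multiplicative ℤ → Prop := fun a t => t.2 = 1 ∧ CommGE S (i + j + 1) a t.1
  let P : ℕ → G × Multiplicative ℤ → Prop := fun a t =>
    (a = i + j ∧ t = (rcomm x y, Multiplicative.ofAdd 1)) ∨ Q a t
  have hPc : ∀ {b : ℕ} {v : G}, IterComm S b v → ∀ a t, P a t →
      Q (a + b) (rcomm t (v, (1 : Multiplicative ℤ))) := by
    rintro b v hv a t (⟨rfl, rfl⟩ | h)
    · exact ⟨by simp [rcomm], by have := hv.pos; omega, .comm (.comm hx hy) hv⟩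
    · exact ⟨by simp [rcomm], by have := h.2.1; omega, .comm h.2.2 hv⟩
  have h1 : ∀ q : ℕ, WordCost P z (rcomm x (y ^ q), Multiplicative.ofAdd (q : ℤ))
      (z ^ i * (Real.exp (q * z ^ j) - 1)) := by
    intro q
    induction q with
    | zero => simpa [← Prod.one_eq_mk] using WordCost.one (P := P) (x := z) le_rfl
    | succ q ih =>
      have e : (rcomm x (y ^ (q + 1)), Multiplicative.ofAdd ((q + 1 : ℕ) : ℤ)) =
          ((rcomm x y, Multiplicative.ofAdd 1) : G × Multiplicative ℤ) * ((y, 1)⁻¹ *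
            (rcomm x (y ^ q), Multiplicative.ofAdd (q : ℤ)) * (y, 1)) := by
        rw [pow_succ, rcomm_mul_right]
        ext
        · simp
        · simp [← ofAdd_add, add_comm]
      rw [e]
      refine ((WordCost.letter (.inl ⟨rfl, rfl⟩)).mul
        (ih.conj_letter hz fun a t ht => .inr (hPc hy a t ht))).mono ?_
      have := WordCost.mul_one_add_le_exp (pow_nonneg hz i)
        (show q * z ^ j + z ^ j ≤ (q + 1 : ℕ) * z ^ j by push_cast; linarith)
      rw [pow_add]
      linarith
  have hq0 : 0 ≤ Real.exp (q * z ^ j) - 1 := by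
    linarith [Real.one_le_exp (show 0 ≤ q * z ^ j by positivity)]
  have h2 : ∀ p : ℕ, WordCost P z (rcomm (x ^ p) (y ^ q), Multiplicative.ofAdd ((p * q : ℕ) : ℤ))
      ((Real.exp (p * z ^ i) - 1) * (Real.exp (q * z ^ j) - 1)) := by
    intro p
    induction p with
    | zero => simpa [← Prod.one_eq_mk] using WordCost.one (P := P) (x := z) le_rfl
    | succ p ih =>
      have e : (rcomm (x ^ (p + 1)) (y ^ q), Multiplicative.ofAdd (((p + 1) * q : ℕ) : ℤ)) =
          ((x, 1)⁻¹ * (rcomm (x ^ p) (y ^ q), Multiplicative.ofAdd ((p * q : ℕ) : ℤ)) * (x, 1)) *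
            ((rcomm x (y ^ q), Multiplicative.ofAdd (q : ℤ)) : G × Multiplicative ℤ) := by
        rw [pow_succ, rcomm_mul_left]
        ext
        · simp
        · simp [add_mul]
      rw [e]
      refine ((ih.conj_letter hz fun a t ht => .inr (hPc hx a t ht)).mul (h1 q)).mono ?_
      have := WordCost.mul_one_add_le_exp hq0
        (show p * z ^ i + z ^ i ≤ (p + 1 : ℕ) * z ^ i by push_cast; linarith)
      linarith
  obtain ⟨a, w, hw, -, hwc⟩ := (h2 p).exists_eq_pow_mul (Q := Q) (k := i + j)
    (u := (rcomm x y, Multiplicative.ofAdd 1)) hz (fun a t h => h)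
    (fun a t h => ⟨by simp [rcomm, h.1], by have := h.2.1; omega, .comm h.2.2 (.comm hx hy)⟩)
  have hw2 : w.2 = 1 := (hwc.map (MonoidHom.snd _ _) (Q := fun _ t => t = 1)
    fun _ _ h => h.1).eq_one fun _ _ h => h
  have ha : a = p * q := by
    have := congrArg Prod.snd hw
    simp only [Prod.snd_mul, Prod.pow_snd, hw2, mul_one, ← ofAdd_nsmul] at this
    have := Multiplicative.ofAdd.injective this
    simp only [nsmul_eq_mul, mul_one] at this
    exact_mod_cast this.symm
  subst ha
  refine ⟨w.1, by simpa using congrArg Prod.fst hw,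
    (hwc.map (MonoidHom.fst _ _) fun _ _ h => h.2).mono ?_⟩
  have hp0 : 0 ≤ Real.exp (p * z ^ i) - 1 := by
    linarith [Real.one_le_exp (show 0 ≤ p * z ^ i by positivity)]
  have hcd : (Real.exp (p * z ^ i) - 1) * (Real.exp (q * z ^ j) - 1) ≤
      (Real.exp c - 1) * (Real.exp d - 1) := by
    have hc0 : 0 ≤ Real.exp c - 1 := hp0.trans (by gcongr)
    gcongr
  have := (mul_nonneg hp0 hq0).trans hcd
  gcongr

end IteratedCommutators

/-! ### Powers of commutators modulo higher weight -/

section Sequences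

variable {G ι : Type*} [Group G] {S : Set G}

/-- The families `g` with `g i` in a word ball of radius `O(n i)`. -/
def linearBall (S : Set G) (hS : S⁻¹ = S) (n : ι → ℕ) : Subgroup (ι → G) where
  carrier := {g | ∃ C : ℕ, ∀ i, g i ∈ S ^ (C * n i)}
  one_mem' := ⟨0, fun i => by simp⟩
  mul_mem' := by
    rintro g h ⟨C, hC⟩ ⟨D, hD⟩
    exact ⟨C + D, fun i => by rw [add_mul, pow_add]; exact Set.mul_mem_mul (hC i) (hD i)⟩
  inv_mem' := by
    rintro g ⟨C, hC⟩
    exact ⟨C, fun i => by rw [← hS, inv_pow]; exact Set.inv_mem_inv.2 (hC i)⟩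

/-- The families `g` such that `g i`, at scale `n i`, is a word of bounded cost in the iterated
commutators of weight at least `k`. -/
def boundedCost (S : Set G) (hS : S⁻¹ = S) (n : ι → ℕ) (k : ℕ) : Subgroup (ι → G) where
  carrier := {g | ∃ C : ℝ, ∀ i, WordCost (CommGE S k) (n i : ℝ)⁻¹ (g i) C}
  one_mem' := ⟨0, fun i => .one le_rfl⟩
  mul_mem' := by
    rintro g h ⟨C, hC⟩ ⟨D, hD⟩
    exact ⟨C + D, fun i => (hC i).mul (hD i)⟩
  inv_mem' := by
    rintro g ⟨C, hC⟩
    exact ⟨C, fun i => (hC i).inv fun k t h => ⟨h.1, h.2.inv hS⟩⟩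

theorem boundedCost_antitone (hS : S⁻¹ = S) (n : ι → ℕ) : Antitone (boundedCost S hS n) :=
  fun _ _ hij _ ⟨C, hC⟩ => ⟨C, fun l => (hC l).imp fun _ _ h => h.mono hij⟩

theorem rcomm_mem_boundedCost (hS : S⁻¹ = S) (n : ι → ℕ) {i j : ℕ} {g h : ι → G}
    (hg : g ∈ boundedCost S hS n i) (hh : h ∈ boundedCost S hS n j) :
    rcomm g h ∈ boundedCost S hS n (i + j) := by
  obtain ⟨C, hC⟩ := hg
  obtain ⟨D, hD⟩ := hh
  refine ⟨_, fun l => (hC l).comm (R := CommGE S (i + j)) (by positivity) ?_ ?_ ?_ (hD l)⟩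
  · exact fun _ _ _ _ ht hv => ht.comm hv
  · exact fun _ _ _ _ ht hv => (ht.comm hv).mono (by omega)
  · exact fun _ _ _ _ ht hv => (ht.comm hv).mono (by omega)

theorem wordCost_of_mem_pow {m : ℕ} {g : G} (hg : g ∈ S ^ m) (x : ℝ) :
    WordCost (CommGE S 1) x g (m * x) := by
  induction m generalizing g with
  | zero => rw [pow_zero, Set.mem_one] at hg; subst hg; exact .one (by simp)
  | succ m ih =>
    rw [pow_succ] at hg
    obtain ⟨a, ha, s, hs, rfl⟩ := hg
    exact .mul_letter (ih ha) ⟨le_rfl, .base hs⟩ (by push_cast; linarith)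

theorem wordCost_of_mem_pow_mul {C n : ℕ} (hn : 1 ≤ n) {g : G} (hg : g ∈ S ^ (C * n)) :
    WordCost (CommGE S 1) (n : ℝ)⁻¹ g C := by
  refine (wordCost_of_mem_pow hg _).mono (le_of_eq ?_)
  have : (n : ℝ) ≠ 0 := by positivity
  push_cast
  field_simp

theorem linearBall_le_boundedCost (hS : S⁻¹ = S) {n : ι → ℕ} (hn : ∀ i, 1 ≤ n i) :
    linearBall S hS n ≤ boundedCost S hS n 1 :=
  fun _ ⟨C, hC⟩ => ⟨C, fun i => wordCost_of_mem_pow_mul (hn i) (hC i)⟩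

/-- The linear balls normalise the bounded-cost subgroup, so their join is a product. -/
theorem exists_of_mem_sup (hS : S⁻¹ = S) {n : ι → ℕ} (hn : ∀ i, 1 ≤ n i) {k : ℕ}
    {g : ι → G} (hg : g ∈ linearBall S hS n ⊔ boundedCost S hS n k) :
    ∃ b ∈ linearBall S hS n, ∃ w ∈ boundedCost S hS n k, b * w = g := by
  have := Subgroup.coe_mul_of_left_le_normalizer_right (linearBall S hS n)
    (boundedCost S hS n k) ?_
  · rw [← SetLike.mem_coe, this] at hg
    exact hg
  · have key : ∀ b ∈ linearBall S hS n, ∀ w ∈ boundedCost S hS n k,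
        b⁻¹ * w * b ∈ boundedCost S hS n k := fun b hb w hw => by
      rw [conj_eq_mul_rcomm]
      exact mul_mem hw (boundedCost_antitone hS n (by omega)
        (rcomm_mem_boundedCost hS n hw (linearBall_le_boundedCost hS hn hb)))
    refine fun b hb => Subgroup.mem_normalizer_iff.2 fun w => ⟨fun hw => ?_, fun hw => ?_⟩
    · simpa using key _ (inv_mem hb) w hw
    · simpa [mul_assoc] using key b hb _ hw

/-- Induction on the commutator: [x, y]^(pq) agrees with [xᵖ, y^q] up to higher weight, and there xᵖ
and y^q may be replaced by elements of length O(n), whose commutator again has length O(n). -/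
theorem IterComm.pow_mem_sup (hS : S⁻¹ = S) (h1 : 1 ∈ S) {n : ι → ℕ} (hn : ∀ i, 1 ≤ n i)
    {k : ℕ} {u : G} (hu : IterComm S k u) (r : ι → ℕ) (hr : ∀ i, r i ≤ n i ^ k) :
    (fun i => u ^ r i) ∈ linearBall S hS n ⊔ boundedCost S hS n (k + 1) := by
  induction hu generalizing r with
  | @base s hs =>
    refine le_sup_left (α := Subgroup (ι → G)) ⟨1, fun i => ?_⟩
    exact Set.pow_subset_pow_right h1 (by simpa using hr i) (Set.pow_mem_pow hs)
  | @comm i j x y hx hy ihx ihy =>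
    have hle : ∀ {l}, i + j + 1 ≤ l → boundedCost S hS n l ≤
        linearBall S hS n ⊔ boundedCost S hS n (i + j + 1) := fun h =>
      (boundedCost_antitone hS n h).trans le_sup_right
    have hcost : ∀ {l : ℕ} {v : G} (p : ι → ℕ), IterComm S l v → (∀ t, p t ≤ n t ^ l) →
        (fun t => v ^ p t) ∈ boundedCost S hS n l := fun {l v} p hv hp =>
      ⟨1, fun t => (WordCost.pow (⟨le_rfl, hv⟩ : CommGE S l l v) (p t)).mono (by
        have := hn t
        rw [inv_pow, ← div_eq_mul_inv, div_le_one (by positivity)]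
        exact_mod_cast hp t)⟩
    have key : ∀ p q : ι → ℕ, (∀ t, p t ≤ n t ^ i) → (∀ t, q t ≤ n t ^ j) →
        (fun t => rcomm x y ^ (p t * q t)) ∈
          linearBall S hS n ⊔ boundedCost S hS n (i + j + 1) := by
      intro p q hp hq
      have hX := hcost p hx hp
      have hY := hcost q hy hq
      obtain ⟨b, hb, w, hw, hbw⟩ := exists_of_mem_sup hS hn (ihx p hp)
      obtain ⟨b', hb', w', hw', hbw'⟩ := exists_of_mem_sup hS hn (ihy q hq)
      -- Short length alone gives only weight 1; comparison with xᵖ raises this to i.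
      have hbi : b ∈ boundedCost S hS n i := by
        rw [← eq_mul_inv_iff_mul_eq] at hbw
        rw [hbw]
        exact mul_mem hX (inv_mem (boundedCost_antitone hS n (by omega) hw))
      have hbj : b' ∈ boundedCost S hS n j := by
        rw [← eq_mul_inv_iff_mul_eq] at hbw'
        rw [hbw']
        exact mul_mem hY (inv_mem (boundedCost_antitone hS n (by omega) hw'))
      have hcc : rcomm b b' ∈ linearBall S hS n :=
        mul_mem (mul_mem (mul_mem (inv_mem hb) (inv_mem hb')) hb) hb'
      have e1 : rcomm b (b' * w') ∈
          linearBall S hS n ⊔ boundedCost S hS n (i + j + 1) := by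
        rw [rcomm_mul_right, conj_eq_mul_rcomm]
        exact mul_mem (hle (by omega) (rcomm_mem_boundedCost hS n hbi hw'))
          (mul_mem (le_sup_left (α := Subgroup (ι → G)) hcc) (hle (by omega)
            (rcomm_mem_boundedCost hS n (rcomm_mem_boundedCost hS n hbi hbj) hw')))
      have e2 : rcomm (b * w) (b' * w') ∈
          linearBall S hS n ⊔ boundedCost S hS n (i + j + 1) := by
        rw [rcomm_mul_left, conj_eq_mul_rcomm, hbw']
        rw [hbw'] at e1
        exact mul_mem (mul_mem e1 (hle (by omega)
          (rcomm_mem_boundedCost hS n (rcomm_mem_boundedCost hS n hbi hY) hw)))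
          (hle (by omega) (rcomm_mem_boundedCost hS n hw hY))
      rw [hbw, hbw'] at e2
      have hle1 : ∀ {l : ℕ} {p : ι → ℕ} (t : ι), p t ≤ n t ^ l →
          (p t : ℝ) * ((n t : ℝ)⁻¹) ^ l ≤ 1 := fun {l p} t hp => by
        have := hn t
        rw [inv_pow, ← div_eq_mul_inv, div_le_one (by positivity)]
        exact_mod_cast hp
      choose v hv hvc using fun t => hx.exists_rcomm_pow_pow hy (z := (n t : ℝ)⁻¹)
        (by positivity) (p t) (q t) (hle1 t (hp t)) (hle1 t (hq t))
      have e3 : (fun t => rcomm x y ^ (p t * q t)) =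
          rcomm (fun t => x ^ p t) (fun t => y ^ q t) * v⁻¹ := by
        rw [eq_mul_inv_iff_mul_eq]
        funext t
        exact (hv t).symm
      rw [e3]
      exact mul_mem e2 (hle le_rfl (inv_mem ⟨_, hvc⟩))
    -- Euclidean division by nʲ writes r as a sum of two products pq with p ≤ nⁱ and q ≤ nʲ.
    have e : (fun t => rcomm x y ^ r t) = (fun t => rcomm x y ^ (r t / n t ^ j * n t ^ j)) *
        fun t => rcomm x y ^ (1 * (r t % n t ^ j)) := by
      funext t
      rw [Pi.mul_apply, ← pow_add, one_mul, Nat.div_add_mod']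
    rw [e]
    have hpos : ∀ t l, 0 < n t ^ l := fun t l => pow_pos (hn t) l
    refine mul_mem (key _ _ (fun t => ?_) fun t => le_rfl)
      (key _ _ (fun t => hpos t i) fun t => (Nat.mod_lt _ (hpos t j)).le)
    exact Nat.div_le_of_le_mul (by rw [← pow_add, add_comm]; exact hr t)

theorem IterComm.exists_pow_eq_mul (hS : S⁻¹ = S) (h1 : 1 ∈ S) {k : ℕ} {u : G}
    (hu : IterComm S k u) :
    ∃ C : ℕ, ∀ n r : ℕ, 1 ≤ n → r ≤ n ^ k → ∃ b ∈ S ^ (C * n), ∃ w,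
      WordCost (CommGE S (k + 1)) (n : ℝ)⁻¹ w C ∧ u ^ r = b * w := by
  -- Indexing by all admissible pairs (n, r) makes the constants uniform.
  obtain ⟨b, ⟨C, hC⟩, w, ⟨D, hD⟩, h⟩ := exists_of_mem_sup hS
    (n := fun i : {i : ℕ × ℕ // 1 ≤ i.1 ∧ i.2 ≤ i.1 ^ k} => i.1.1) (fun i => i.2.1)
    (hu.pow_mem_sup hS h1 (fun i => i.2.1) (fun i => i.1.2) fun i => i.2.2)
  refine ⟨max C ⌈D⌉₊, fun n r hn hr => ?_⟩
  have hC := hC ⟨(n, r), hn, hr⟩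
  have hD := hD ⟨(n, r), hn, hr⟩
  refine ⟨_, Set.pow_subset_pow_right h1 (Nat.mul_le_mul_right _ (le_max_left _ _)) hC, _,
    hD.mono ((Nat.le_ceil D).trans (by exact_mod_cast le_max_right _ _)), ?_⟩
  exact (congrFun h ⟨(n, r), hn, hr⟩).symm

end Sequences

/-! ### Coverings of balls -/

section Covering

variable {G : Type*} [Group G] {S : Set G}

/-- At every scale `n`, words of bounded cost are covered by boundedly many translates of a ball of
radius `O(n)`, the implied constant of the radius being independent of the cost. -/
def HasCovering (S : Set G) (P : ℕ → G → Prop) : Prop :=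
  ∃ D : ℕ, ∀ C : ℝ, ∃ M : ℕ, ∀ n : ℕ, 1 ≤ n → ∃ X : Finset G, X.card ≤ M ∧
    ∀ g, WordCost P (n : ℝ)⁻¹ g C → g ∈ (X : Set G) * S ^ (D * n)

theorem HasCovering.insert (hS : S⁻¹ = S) (h1 : 1 ∈ S) {P Q : ℕ → G → Prop} {k : ℕ} {u : G}
    (hu : IterComm S k u) (hQ : ∀ a t, Q a t → CommGE S k a t)
    (hQ' : ∀ a t, CommGE S (k + 1) a t → Q a t)
    (hPQ : ∀ a t, P a t → (a = k ∧ t = u) ∨ Q a t) (h : HasCovering S Q) : HasCovering S P := by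
  classical
  obtain ⟨D, hD⟩ := h
  obtain ⟨B, hB⟩ := hu.exists_pow_eq_mul hS h1
  have hQc : ∀ i, 1 ≤ i → ∀ a b t v, Q a t → CommGE S i b v → Q (a + b) (rcomm t v) :=
    fun i hi a b t v ht hv => hQ' _ _ (((hQ a t ht).comm hv).mono (by omega))
  refine ⟨D + B, fun C => ?_⟩
  obtain ⟨M, hM⟩ := hD ((B + C * Real.exp C) * Real.exp B)
  refine ⟨(⌊C⌋₊ + 1) * M, fun n hn => ?_⟩
  obtain ⟨X, hXM, hX⟩ := hM n hn
  refine ⟨(Finset.range (⌊C⌋₊ + 1)).image (fun q => (u ^ n ^ k) ^ q) * X, ?_, fun g hg => ?_⟩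
  · refine Finset.card_mul_le.trans (Nat.mul_le_mul (Finset.card_image_le.trans ?_) hXM)
    rw [Finset.card_range]
  · have hx : (0 : ℝ) ≤ (n : ℝ)⁻¹ := by positivity
    obtain ⟨a, w, rfl, haC, hw⟩ := hg.exists_eq_pow_mul hx hPQ
      fun a t ht => hQc 1 le_rfl a k t u ht ⟨hu.pos, hu⟩
    have hpos : 0 < n ^ k := pow_pos hn k
    obtain ⟨b, hb, w', hw', hbw⟩ := hB n (a % n ^ k) hn (Nat.mod_lt _ hpos).le
    have hbi : b⁻¹ ∈ S ^ (B * n) := by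
      rw [← hS, inv_pow]
      exact Set.inv_mem_inv.2 hb
    have hq : a / n ^ k ≤ ⌊C⌋₊ := by
      refine Nat.le_floor (Nat.cast_div_le.trans ?_)
      push_cast
      rwa [div_eq_mul_inv, ← inv_pow]
    -- With uʳ = bw', the tail bw'w equals (bw'wb⁻¹)b. The conjugate is covered by hypothesis, and b
    -- only enlarges the radius by Bn, with B independent of C.
    have hcov := hX _ (((hw'.imp hQ').mul hw).conj hx (hQc 1 le_rfl)
      (wordCost_of_mem_pow_mul hn hbi))
    obtain ⟨y, hy, z, hz, hyz⟩ := hcov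
    refine ⟨(u ^ n ^ k) ^ (a / n ^ k) * y, ?_, z * b, ?_, ?_⟩
    · rw [Finset.coe_mul]
      refine Set.mul_mem_mul ?_ hy
      simp only [Finset.coe_image]
      exact ⟨_, by simpa [Nat.lt_succ_iff] using hq, rfl⟩
    · rw [add_mul, pow_add]
      exact Set.mul_mem_mul hz hb
    · have e : u ^ a = (u ^ n ^ k) ^ (a / n ^ k) * (b * w') := by
        rw [← hbw, ← pow_mul, ← pow_add, Nat.div_add_mod]
      simp only at hyz ⊢
      rw [e, mul_assoc, ← mul_assoc y, hyz]
      group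

/-- Finitely many commutators have weight k, so they can be inserted one at a time. -/
theorem HasCovering.of_succ (hS : S⁻¹ = S) (h1 : 1 ∈ S) (hfin : S.Finite) (k : ℕ)
    (h : HasCovering S (CommGE S (k + 1))) : HasCovering S (CommGE S k) := by
  have key : ∀ Z : Set G, Z.Finite → Z ⊆ {u | IterComm S k u} →
      HasCovering S (fun a t => (a = k ∧ t ∈ Z) ∨ CommGE S (k + 1) a t) := by
    intro Z hZ
    induction Z, hZ using Set.Finite.induction_on with
    | empty => intro _; simpa using h
    | @insert u Z _ _ ih =>
      intro hsub
      refine (ih ((Set.subset_insert _ _).trans hsub)).insert hS h1 (hsub (Set.mem_insert _ _))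
        ?_ (fun a t ht => .inr ht) ?_
      · rintro a t (⟨rfl, ht⟩ | ht)
        · exact ⟨le_rfl, hsub (Set.mem_insert_of_mem _ ht)⟩
        · exact ht.mono (by omega)
      · rintro a t (⟨rfl, rfl | ht⟩ | ht)
        · exact .inl ⟨rfl, rfl⟩
        · exact .inr (.inl ⟨rfl, ht⟩)
        · exact .inr (.inr ht)
  obtain ⟨D, hD⟩ := key _ (IterComm.finite hfin k) subset_rfl
  refine ⟨D, fun C => ?_⟩
  obtain ⟨M, hM⟩ := hD C
  refine ⟨M, fun n hn => ?_⟩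
  obtain ⟨X, hXM, hX⟩ := hM n hn
  refine ⟨X, hXM, fun g hg => hX g (hg.imp fun a t ht => ?_)⟩
  rcases ht.1.eq_or_lt with rfl | h
  · exact .inl ⟨rfl, ht.2⟩
  · exact .inr ⟨h, ht.2⟩

theorem exists_cover_of_nilpotent (hS : S⁻¹ = S) (h1 : 1 ∈ S) (hfin : S.Finite) {N : Subgroup G}
    (hN : Group.IsNilpotent N) (hSN : S ⊆ N) (K : ℕ) :
    ∃ M n₀ : ℕ, ∀ n, n₀ ≤ n → ∃ X : Finset G, X.card ≤ M ∧ S ^ (K * n) ⊆ (X : Set G) * S ^ n := by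
  obtain ⟨m, hm⟩ := IterComm.exists_eq_one hN hSN
  have hbase : HasCovering S (CommGE S (m + 1)) := by
    refine ⟨0, fun C => ⟨1, fun n _ => ⟨{1}, by simp, fun g hg => ?_⟩⟩⟩
    rw [hg.eq_one fun k t ht => hm k (by have := ht.1; omega) t ht.2]
    simp
  obtain ⟨D, hD⟩ : HasCovering S (CommGE S 1) :=
    Nat.decreasingInduction (motive := fun k _ => HasCovering S (CommGE S k))
      (fun k _ h => h.of_succ hS h1 hfin k) hbase (Nat.le_add_left 1 m)
  -- The scale is n / (D + 1), so that radius D times the scale is at most n. The factor 2 absorbs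
  -- the floor. The cost depends on D, hence D must be fixed before C.
  obtain ⟨M, hM⟩ := hD ((2 * K * (D + 1) : ℕ) : ℝ)
  refine ⟨M, D + 1, fun n hn => ?_⟩
  have hn' : 1 ≤ n / (D + 1) := (Nat.one_le_div_iff (by omega)).2 hn
  have hlt := Nat.lt_mul_div_succ n (Nat.succ_pos D)
  have hle := Nat.mul_div_le n (D + 1)
  rw [Nat.succ_eq_add_one] at hlt
  obtain ⟨X, hXM, hX⟩ := hM _ hn'
  refine ⟨X, hXM, fun g hg => ?_⟩
  have hg' := Set.pow_subset_pow_right h1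
    (show K * n ≤ 2 * K * (D + 1) * (n / (D + 1)) by
      have : n ≤ 2 * ((D + 1) * (n / (D + 1))) := by nlinarith
      calc K * n ≤ K * (2 * ((D + 1) * (n / (D + 1)))) := Nat.mul_le_mul_left _ this
        _ = _ := by ring) hg
  refine Set.mul_subset_mul_left (Set.pow_subset_pow_right h1 ?_)
    (hX g (wordCost_of_mem_pow_mul hn' hg'))
  exact (Nat.mul_le_mul_right _ (Nat.le_succ D)).trans hle

/-! ### Passage to a finite-index subgroup -/

theorem exists_mem_pow_of_mem_closure (hS : S⁻¹ = S) {g : G} (hg : g ∈ Subgroup.closure S) :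
    ∃ n : ℕ, g ∈ S ^ n := by
  induction hg using Subgroup.closure_induction with
  | mem x hx => exact ⟨1, by simpa using hx⟩
  | one => exact ⟨0, by simp⟩
  | mul x y _ _ hx hy =>
    obtain ⟨m, hm⟩ := hx
    obtain ⟨n, hn⟩ := hy
    exact ⟨m + n, by rw [pow_add]; exact Set.mul_mem_mul hm hn⟩
  | inv x _ hx =>
    obtain ⟨m, hm⟩ := hx
    exact ⟨m, by rw [← hS, inv_pow]; exact Set.inv_mem_inv.2 hm⟩

theorem exists_subset_pow_of_finite (hS : S⁻¹ = S) (h1 : 1 ∈ S) {T : Set G} (hT : T.Finite)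
    (hTS : T ⊆ Subgroup.closure S) : ∃ n : ℕ, T ⊆ S ^ n := by
  choose! f hf using fun g (hg : g ∈ T) => exists_mem_pow_of_mem_closure hS (hTS hg)
  obtain ⟨n, hn⟩ := (hT.image f).bddAbove
  exact ⟨n, fun g hg => Set.pow_subset_pow_right h1 (hn ⟨g, hg, rfl⟩) (hf g hg)⟩

theorem exists_transversal (N H : Subgroup G) [N.FiniteIndex] :
    ∃ R : Set G, R.Finite ∧ 1 ∈ R ∧ R ⊆ H ∧ ∀ g ∈ H, ∃ r ∈ R, r⁻¹ * g ∈ N := by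
  obtain ⟨R, hRH, hR⟩ := Set.exists_subset_bijOn (H : Set G) (QuotientGroup.mk : G → G ⧸ N)
  refine ⟨insert 1 R, (Set.Finite.of_finite_image (Set.toFinite _) hR.injOn).insert 1,
    Set.mem_insert _ _, Set.insert_subset H.one_mem hRH, fun g hg => ?_⟩
  obtain ⟨r, hr, hrg⟩ := hR.surjOn ⟨g, hg, rfl⟩
  exact ⟨r, Set.mem_insert_of_mem _ hr, QuotientGroup.eq.1 hrg⟩

theorem exists_cover_of_isVirtuallyNilpotent (hG : Group.IsVirtuallyNilpotent G) (hS : S⁻¹ = S)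
    (h1 : 1 ∈ S) (hfin : S.Finite) (K : ℕ) :
    ∃ M n₀ : ℕ, ∀ n, n₀ ≤ n → ∃ X : Finset G, X.card ≤ M ∧ S ^ (K * n) ⊆ (X : Set G) * S ^ n := by
  classical
  obtain ⟨N, hN, _⟩ := hG
  obtain ⟨R, hRfin, hR1, hRS, hR⟩ := exists_transversal N (Subgroup.closure S)
  -- Schreier generators: sr = r'(r'⁻¹sr) pushes coset representatives to the left.
  set T : Set G := (R⁻¹ * S * R) ∩ N with hT
  have hTsymm : T⁻¹ = T := by
    rw [hT, Set.inter_inv, mul_inv_rev, mul_inv_rev, inv_inv, hS, inv_coe_set, mul_assoc]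
  have hT1 : (1 : G) ∈ T := by
    refine ⟨?_, N.one_mem⟩
    simpa using Set.mul_mem_mul (Set.mul_mem_mul (Set.inv_mem_inv.2 hR1) h1) hR1
  have hTfin : T.Finite := ((hRfin.inv.mul hfin).mul hRfin).inter_of_left _
  have hTS : T ⊆ Subgroup.closure S := by
    rintro _ ⟨⟨_, ⟨a, ha, s, hs, rfl⟩, b, hb, rfl⟩, -⟩
    refine mul_mem (mul_mem ?_ (Subgroup.subset_closure hs)) (hRS hb)
    simpa using inv_mem (hRS ha)
  have hRT : ∀ n : ℕ, S ^ n ⊆ R * T ^ n := by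
    intro n
    induction n with
    | zero => simpa using hR1
    | succ n ih =>
      rw [pow_succ', pow_succ']
      rintro _ ⟨s, hs, g, hg, rfl⟩
      obtain ⟨r, hr, t, ht, rfl⟩ := ih hg
      obtain ⟨r', hr', hN'⟩ := hR (s * r) (mul_mem (Subgroup.subset_closure hs) (hRS hr))
      refine ⟨r', hr', r'⁻¹ * (s * r) * t, Set.mul_mem_mul ⟨?_, hN'⟩ ht, by simp; group⟩
      rw [← mul_assoc]
      exact Set.mul_mem_mul (Set.mul_mem_mul (Set.inv_mem_inv.2 hr') hs) hr
  obtain ⟨c, hc⟩ := exists_subset_pow_of_finite hS h1 hTfin hTS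
  obtain ⟨M, n₀, hM⟩ := exists_cover_of_nilpotent hTsymm hT1 hTfin hN Set.inter_subset_right
    (2 * K * (c + 1))
  refine ⟨hRfin.toFinset.card * M, (c + 1) * (n₀ + 1), fun n hn => ?_⟩
  have hn' : n₀ + 1 ≤ n / (c + 1) := (Nat.le_div_iff_mul_le (by omega)).2 (by linarith)
  have hlt := Nat.lt_mul_div_succ n (Nat.succ_pos c)
  have hle := Nat.mul_div_le n (c + 1)
  rw [Nat.succ_eq_add_one] at hlt
  obtain ⟨X, hXM, hX⟩ := hM _ (Nat.le_of_succ_le hn')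
  refine ⟨hRfin.toFinset * X, Finset.card_mul_le.trans (Nat.mul_le_mul_left _ hXM), ?_⟩
  have hKn : K * n ≤ 2 * K * (c + 1) * (n / (c + 1)) := by
    have : n ≤ 2 * ((c + 1) * (n / (c + 1))) := by nlinarith
    calc K * n ≤ K * (2 * ((c + 1) * (n / (c + 1)))) := Nat.mul_le_mul_left _ this
      _ = _ := by ring
  have hTn : T ^ (n / (c + 1)) ⊆ S ^ n := by
    refine (Set.pow_subset_pow_left hc).trans ?_
    rw [← pow_mul]
    exact Set.pow_subset_pow_right h1 ((Nat.mul_le_mul_right _ (Nat.le_succ c)).trans hle)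
  rw [Finset.coe_mul, Set.Finite.coe_toFinset, mul_assoc]
  exact (hRT _).trans (Set.mul_subset_mul_left ((Set.pow_subset_pow_right hT1 hKn).trans
    (hX.trans (Set.mul_subset_mul_left hTn))))

theorem pow_subset_wordBall (n : ℕ) : S ^ n ⊆ wordBall S n := by
  refine fun g hg => ⟨?_, Nat.sInf_le hg⟩
  have : S ^ n ⊆ (Subgroup.closure S : Set G) := by
    induction n generalizing g with
    | zero => simp
    | succ n ih =>
      rw [pow_succ]
      rintro _ ⟨a, ha, s, hs, rfl⟩
      exact mul_mem (ih a ha ha) (Subgroup.subset_closure hs)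
  exact this hg

end Covering

/-! ### Conclusion -/

theorem mainTheorem4 {G : Type*} [Group G] (hG : Group.IsVirtuallyNilpotent G)
    (A : Set G) (hA_fin : A.Finite) (hA_ne : A.Nonempty)
    (S : Set G) (hS_fin : S.Finite) (hS_symm : S⁻¹ = S) (hS_one : (1 : G) ∈ S)
    (hS_gen : Subgroup.closure S = Subgroup.closure A)
    (hball : ∃ θ : ℝ, 0 < θ ∧ ∃ h₁ : ℕ, 1 ≤ h₁ ∧
      ∀ h : ℕ, h₁ ≤ h → wordBall S ⌊θ * (h : ℝ)⌋₊ ⊆ A ^ h) :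
    IsAsymptoticApproximateGroup A := by
  intro r _
  obtain ⟨θ, hθ, h₁, hh₁, hball⟩ := hball
  obtain ⟨m, hm⟩ := exists_subset_pow_of_finite hS_symm hS_one hA_fin
    (hS_gen ▸ Subgroup.subset_closure)
  -- The 2 pays for θh / 2 ≤ ⌊θh⌋, valid for large h.
  set K : ℕ := ⌈2 * (m * r) / θ⌉₊
  obtain ⟨M, n₀, hM⟩ := exists_cover_of_isVirtuallyNilpotent hG hS_symm hS_one hS_fin K
  refine ⟨M + 1, by omega, hA_ne, max h₁ ⌈(2 + n₀) / θ⌉₊, le_max_of_le_left hh₁, fun h hh => ?_⟩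
  have hlarge : 2 + n₀ ≤ θ * h := by
    have := (Nat.le_ceil ((2 + n₀) / θ)).trans
      (Nat.cast_le.2 ((le_max_right h₁ _).trans hh))
    rw [div_le_iff₀ hθ] at this
    linarith
  obtain ⟨X, hXM, hX⟩ := hM ⌊θ * h⌋₊ (Nat.le_floor (by linarith))
  refine ⟨X, by omega, ?_⟩
  have hle : m * (r * h) ≤ K * ⌊θ * h⌋₊ := by
    have h2 : θ * h / 2 ≤ ⌊θ * h⌋₊ := by
      have := Nat.lt_floor_add_one (θ * h)
      have : (0 : ℝ) ≤ n₀ := by positivity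
      linarith
    have h3 : 2 * (m * r) / θ ≤ (K : ℝ) := Nat.le_ceil _
    have h4 : (m * (r * h) : ℝ) ≤ K * ⌊θ * h⌋₊ :=
      calc (m * (r * h) : ℝ) = 2 * (m * r) / θ * (θ * h / 2) := by field_simp
        _ ≤ K * ⌊θ * h⌋₊ := by gcongr
    exact_mod_cast h4
  calc A ^ (r * h) ⊆ (S ^ m) ^ (r * h) := Set.pow_subset_pow_left hm
    _ = S ^ (m * (r * h)) := (pow_mul _ _ _).symm
    _ ⊆ S ^ (K * ⌊θ * h⌋₊) := Set.pow_subset_pow_right hS_one hle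
    _ ⊆ X * S ^ ⌊θ * h⌋₊ := hX
    _ ⊆ X * A ^ h := Set.mul_subset_mul_left ((pow_subset_wordBall _).trans
        (hball h ((le_max_left _ _).trans hh)))
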